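/- Conventions. $P(\mathbb N)$ is the family of all subsets of $\mathbb N$ with the topology of the Cantor space $\{0,1\}^{\mathbb N}$ (via characteristic functions); $[\mathbb N]^{\infty}$ and $\mathrm{Fin}$ are the subspaces of infinite and of finite subsets of $\mathbb N$. Each $a\in[\mathbb N]^{\infty}$ is identified with its increasing enumeration $n\mapsto a(n)$, and for $a,b\in[\mathbb N]^\infty$ we put $[a\le b]=\{n : a(n)\le b(n)\}$ and write $a\le^* b$ if $a(n)\le b(n)$ for all but finitely many $n$. $\mathfrak b$ is the minimal cardinality of a subset of $[\mathbb N]^\infty$ with no $\le^*$-upper bound in $[\mathbb N]^\infty$; $\mathfrak d$ is the minimal cardinality of a set $D\subseteq[\mathbb N]^\infty$ such that for every $a\in[\mathbb N]^\infty$ there is $d\in D$ with $a\le^* d$. A semifilter is a set $S\subseteq[\mathbb N]^\infty$ such that $b\in S$ whenever $s\in S$, $b\in[\mathbb N]^\infty$ and $s\setminus b$ is finite. It is nonmeager if it is not a meager (first category) subset of $P(\mathbb N)$. Put $S^+=\{a\in[\mathbb N]^\infty : \mathbb N\setminus a\notin S\}$. For a family $T\subseteq[\mathbb N]^\infty$ write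 $a\le_T b$ if $[a\le b]\in T$. $\mathfrak b(S)$ is the minimal cardinality of a subset of $[\mathbb N]^\infty$ with no $\le_S$-upper bound in $[\mathbb N]^\infty$. A set $X\subseteq[\mathbb N]^\infty$ with $|X|\ge\mathfrak b(S)$ is an $S$-scale if for every $b\in[\mathbb N]^\infty$ there is $c\in[\mathbb N]^\infty$ such that $b\le_{S^+}c$ and $c\le_S x$ for all but fewer than $\mathfrak b(S)$ elements $x\in X$; it is a cofinal $S$-scale if for every $b\in[\mathbb N]^\infty$, $b\le_S x$ for all but fewer than $\mathfrak b(S)$ elements $x\in X$. A set $Y\subseteq\mathbb R$ with $|Y|\ge\mathfrak d$ is $\mathfrak d$-concentrated if there is a countable set $D\subseteq Y$ such that $|Y\setminus U|<\mathfrak d$ for every open set $U\supseteq D$. A topological space is Menger if for every sequence $\mathcal U_1,\mathcal U_2,\dots$ of open covers there are finite sets $\mathcal F_n\subseteq\mathcal U_n$ such that $\bigcup_n\mathcal F_n$ covers the space. Theorem. Assume that $\mathfrak b=\mathfrak d$, and let $S$ be a semifilter. The following assertions are equivalent: 1. The semifilter $S$ is nonmeager. 2. There are an $S$-scale $X\subseteq[\mathbb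 N]^\infty$ and a $\mathfrak d$-concentrated set $Y\subseteq\mathbb R$ such that the product space $(X\cup\mathrm{Fin})\times Y$ is not Menger. 3. There are a cofinal $S$-scale $X\subseteq[\mathbb N]^\infty$ and a $\mathfrak d$-concentrated set $Y\subseteq\mathbb R$ such that the product space $(X\cup\mathrm{Fin})\times Y$ is not Menger. -/

import Mathlib

open Cardinal

namespace SemifilterScales

/-! ### Infinite sets of natural numbers as points and as functions -/

/-- The topology of the Cantor space on the power set of `ℕ`: a set is identified with its
characteristic function in `ℕ → Bool`. -/
noncomputable instance powerSetTopology : TopologicalSpace (Set ℕ) :=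
  TopologicalSpace.induced
    (fun (a : Set ℕ) (n : ℕ) => (open Classical in decide (n ∈ a) : Bool)) inferInstance

/-- The family of infinite subsets of `ℕ`. -/
def InfSets : Set (Set ℕ) := {a | a.Infinite}

/-- The family of finite subsets of `ℕ`. -/
def FinSets : Set (Set ℕ) := {a | a.Finite}

/-- The increasing enumeration of an infinite set `a`, starting with index `0`. -/
noncomputable def enum (a : Set ℕ) : ℕ → ℕ := Nat.nth (fun k => k ∈ a)

/-- The set `[a ≤ b]` of all `n` with `a(n) ≤ b(n)`. -/
def leSet (a b : Set ℕ) : Set ℕ := {n | enum a n ≤ enum b n}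

/-- `a ≤* b`: `a(n) ≤ b(n)` for all but finitely many `n`. -/
def LeStar (a b : Set ℕ) : Prop := {n | enum b n < enum a n}.Finite

/-- `a ≤_S b`: the set `[a ≤ b]` belongs to `S`. -/
def LeMod (S : Set (Set ℕ)) (a b : Set ℕ) : Prop := leSet a b ∈ S

/-! ### Cardinal invariants -/

/-- `X` has an upper bound in the family of infinite sets, with respect to the relation `R`. -/
def BoundedFor (R : Set ℕ → Set ℕ → Prop) (X : Set (Set ℕ)) : Prop :=
  ∃ c ∈ InfSets, ∀ x ∈ X, R x c

/-- The minimal cardinality of a family of infinite sets that is unbounded with respect to `R`. -/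
noncomputable def unboundedNumber (R : Set ℕ → Set ℕ → Prop) : Cardinal.{0} :=
  sInf {κ | ∃ X : Set (Set ℕ), X ⊆ InfSets ∧ ¬ BoundedFor R X ∧ #X = κ}

/-- The cardinal `𝔟`. -/
noncomputable def boundingNumber : Cardinal.{0} := unboundedNumber LeStar

/-- The cardinal `𝔟(S)`. -/
noncomputable def boundingNumberOf (S : Set (Set ℕ)) : Cardinal.{0} := unboundedNumber (LeMod S)

/-- A dominating family of infinite sets. -/
def IsDominating (X : Set (Set ℕ)) : Prop :=
  X ⊆ InfSets ∧ ∀ a ∈ InfSets, ∃ x ∈ X, LeStar a x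

/-- The cardinal `𝔡`. -/
noncomputable def dominatingNumber : Cardinal.{0} :=
  sInf {κ | ∃ X : Set (Set ℕ), IsDominating X ∧ #X = κ}

/-! ### Semifilters and scales -/

/-- A semifilter: a family of infinite sets closed under almost supersets. -/
def IsSemifilter (S : Set (Set ℕ)) : Prop :=
  S ⊆ InfSets ∧ ∀ s ∈ S, ∀ b ∈ InfSets, (s \ b).Finite → b ∈ S

/-- The family `S⁺` of all infinite sets whose complement is not in `S`. -/
def plus (S : Set (Set ℕ)) : Set (Set ℕ) := {a | a ∈ InfSets ∧ aᶜ ∉ S}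

/-- `X` is an `S`-scale. -/
def IsScale (S X : Set (Set ℕ)) : Prop :=
  X ⊆ InfSets ∧ boundingNumberOf S ≤ #X ∧
    ∀ b ∈ InfSets, ∃ c ∈ InfSets, LeMod (plus S) b c ∧
      #{x : Set ℕ | x ∈ X ∧ ¬ LeMod S c x} < boundingNumberOf S

/-- `X` is a cofinal `S`-scale. -/
def IsCofinalScale (S X : Set (Set ℕ)) : Prop :=
  X ⊆ InfSets ∧ boundingNumberOf S ≤ #X ∧
    ∀ b ∈ InfSets, #{x : Set ℕ | x ∈ X ∧ ¬ LeMod S b x} < boundingNumberOf S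

/-! ### Topological properties -/

/-- `𝒰` is an open cover of the space `X`. -/
def IsOpenCover (X : Type) [TopologicalSpace X] (𝒰 : Set (Set X)) : Prop :=
  (∀ U ∈ 𝒰, IsOpen U) ∧ ⋃₀ 𝒰 = Set.univ

/-- Menger's property of a topological space. -/
def IsMenger (X : Type) [TopologicalSpace X] : Prop :=
  ∀ 𝒰 : ℕ → Set (Set X), (∀ n, IsOpenCover X (𝒰 n)) →
    ∃ ℱ : ℕ → Set (Set X), (∀ n, ℱ n ⊆ 𝒰 n ∧ (ℱ n).Finite) ∧ ⋃₀ (⋃ n, ℱ n) = Set.univ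

/-- The space `X` has cardinality at least `κ` and is `κ`-concentrated on some countable subset
`D`: every open set containing `D` contains all but less than `κ` points of `X`. -/
def IsConcentrated (κ : Cardinal.{0}) (X : Type) [TopologicalSpace X] : Prop :=
  κ ≤ #X ∧ ∃ D : Set X, D.Countable ∧
    ∀ U : Set X, IsOpen U → D ⊆ U → #(Uᶜ : Set X) < κ

end SemifilterScales

namespace SemifilterScales

open Set Filter Topology

/-! ### Enumerations -/

/-! When 𝔟 = 𝔡, every nonempty semifilter has 𝔟(S) = 𝔟 = 𝔡, so all notions of "few exceptions" in
the theorem agree. Both directions rest on Talagrand's description of meagerness: S is meager iff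
some interval partition of ℕ has almost all its blocks met by each member of S.

If S is meager, such a partition turns "C ≤ x on a set in S" into "b ≤ x almost everywhere on I",
where the infinite set I depends on b but not on x (`IsScale.isInfinitelyOftenScale`). By
compactness, an open set containing Fin × D then contains {x} × V for all but few x, with V from a
countable list of open sets around D (`IsInfinitelyOftenScale.exists_isOpen`). A concentrated Y
loses few points to that list. What remains is fewer than 𝔟 slices, each easily covered, and such
unions are harmless (`IsCoveredOften.iUnion`).

If S is nonmeager, each h in a 𝔡-scale gives disjoint sets x, p with h ≤_S x and h ≤ p, such that x
contains intervals [a, h(a)) for infinitely many a (`exists_sparse_pair`). The sets x form X; the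
pairs (x, p), with all (cofinite, finite) pairs added, form Y. The map (a, (u, v)) ↦ (a Δ u) ∪ v is
continuous with infinite values, and sends (x, (x, p)) to p. Its image is therefore dominating,
which no image of a Menger space is. -/

theorem enum_strictMono {a : Set ℕ} (ha : a ∈ InfSets) : StrictMono (enum a) :=
  Nat.nth_strictMono (p := fun k => k ∈ a) ha

theorem range_mem_infSets {g : ℕ → ℕ} (hg : StrictMono g) : range g ∈ InfSets :=
  infinite_range_of_injective hg.injective

theorem range_enum {a : Set ℕ} (ha : a ∈ InfSets) : range (enum a) = a :=
  Nat.range_nth_of_infinite (p := fun k => k ∈ a) ha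

theorem enum_range {g : ℕ → ℕ} (hg : StrictMono g) : enum (range g) = g :=
  (StrictMono.range_inj (enum_strictMono (range_mem_infSets hg)) hg).1
    (range_enum (range_mem_infSets hg))

/-- Duality between enumeration and counting; it translates growth of a set into conditions on its
initial segments, hence into the Cantor topology. -/
theorem le_enum_iff {a : Set ℕ} (ha : a ∈ InfSets) {m n : ℕ} :
    m ≤ enum a n ↔ (a ∩ Iio m).ncard ≤ n := by
  classical
  have h := Nat.count_le_iff_le_nth (p := fun k => k ∈ a) ha (a := m) (b := n)
  rw [Nat.count_eq_card_filter_range] at h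
  have e : a ∩ Iio m = (((Finset.range m).filter fun k => k ∈ a : Finset ℕ) : Set ℕ) := by
    ext k; simp [and_comm]
  rw [e, ncard_coe_finset]
  exact h.symm

theorem leStar_iff {a b : Set ℕ} : LeStar a b ↔ ∀ᶠ n in atTop, enum a n ≤ enum b n := by
  rw [← Nat.cofinite_eq_atTop, eventually_cofinite]
  simp [LeStar]

theorem exists_strictMono_ge (f : ℕ → ℕ) : ∃ g : ℕ → ℕ, StrictMono g ∧ ∀ n, f n ≤ g n := by
  refine ⟨fun n => ∑ k ∈ Finset.range (n + 1), (f k + 1), strictMono_nat_of_lt_succ fun n => ?_,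
    fun n => ?_⟩
  · rw [Finset.sum_range_succ _ (n + 1)]; omega
  · dsimp only; rw [Finset.sum_range_succ]; omega

/-! ### Bounding and dominating numbers -/

theorem exists_bound {ι : Type} (F : ι → ℕ → ℕ) (h : #ι < boundingNumber) :
    ∃ g : ℕ → ℕ, StrictMono g ∧ ∀ i, ∀ᶠ n in atTop, F i n ≤ g n := by
  choose G hG hFG using fun i => exists_strictMono_ge (F i)
  have hX : BoundedFor LeStar (range fun i => range (G i)) := by
    by_contra hc
    refine notMem_of_lt_csInf (mk_range_le.trans_lt h) (OrderBot.bddBelow _) ⟨_, ?_, hc, rfl⟩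
    rintro _ ⟨i, rfl⟩
    exact range_mem_infSets (hG i)
  obtain ⟨c, hc, hcX⟩ := hX
  refine ⟨enum c, enum_strictMono hc, fun i => ?_⟩
  have h1 := leStar_iff.1 (hcX _ ⟨i, rfl⟩)
  rw [enum_range (hG i)] at h1
  exact h1.mono fun n hn => (hFG i n).trans hn

theorem not_leStar_of_lt {a b : Set ℕ} (h : ∀ᶠ n in atTop, enum b n < enum a n) :
    ¬ LeStar a b := fun h' => by
  obtain ⟨n, h1, h2⟩ := (h.and (leStar_iff.1 h')).exists
  omega

theorem not_boundedFor_infSets : ¬ BoundedFor LeStar InfSets := by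
  rintro ⟨c, hc, h⟩
  have hg : StrictMono fun n => enum c n + 1 := (enum_strictMono hc).add_const 1
  refine not_leStar_of_lt (Eventually.of_forall fun n => ?_) (h _ (range_mem_infSets hg))
  rw [enum_range hg]
  exact Nat.lt_succ_self _

theorem boundingNumber_mem :
    boundingNumber ∈ {κ | ∃ X : Set (Set ℕ), X ⊆ InfSets ∧ ¬ BoundedFor LeStar X ∧ #X = κ} :=
  csInf_mem ⟨_, InfSets, subset_rfl, not_boundedFor_infSets, rfl⟩

theorem exists_bound_nat (F : ℕ → ℕ → ℕ) : ∃ g : ℕ → ℕ, ∀ i n, i ≤ n → F i n ≤ g n :=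
  ⟨fun n => (Finset.range (n + 1)).sup fun i => F i n, fun i n h =>
    Finset.le_sup (f := fun i => F i n) (Finset.mem_range.2 (by omega))⟩

theorem aleph0_lt_boundingNumber : ℵ₀ < boundingNumber := by
  by_contra! hle
  obtain ⟨X, hX, hb, hc⟩ := boundingNumber_mem
  rw [← hc, mk_le_aleph0_iff] at hle
  refine hb ?_
  rcases X.eq_empty_or_nonempty with rfl | hne
  · exact ⟨Set.univ, infinite_univ, by simp⟩
  obtain ⟨e, he⟩ := (countable_coe_iff.1 hle).exists_eq_range hne
  obtain ⟨g, hg⟩ := exists_bound_nat fun i => enum (e i)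
  obtain ⟨g', hg', hgg⟩ := exists_strictMono_ge g
  refine ⟨range g', range_mem_infSets hg', ?_⟩
  rw [he]
  rintro _ ⟨i, rfl⟩
  rw [leStar_iff, enum_range hg']
  filter_upwards [eventually_ge_atTop i] with n hn
  exact (hg i n hn).trans (hgg n)

/-- 𝔟 has uncountable cofinality: an unbounded family of size 𝔟 spread over the pieces would be
bounded piece by piece, and the countably many bounds have a common one. -/
theorem mk_iUnion_lt_boundingNumber {α : Type} {A : ℕ → Set α} (h : ∀ n, #(A n) < boundingNumber) :
    #(⋃ n, A n) < boundingNumber := by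
  by_contra! hle
  obtain ⟨X, hX, hb, hc⟩ := boundingNumber_mem
  rw [← hc] at hle
  obtain ⟨e⟩ := Cardinal.le_def _ _ |>.1 hle
  choose c hc' hcb using fun n => exists_bound
    (ι := {x : X // (e x : α) ∈ A n}) (fun x => enum x.1.1)
    ((mk_le_of_injective (f := fun x => (⟨(e x.1 : α), x.2⟩ : A n)) (by
      intro x y hxy
      exact Subtype.ext (e.injective (Subtype.ext (congrArg (fun z : A n => (z : α)) hxy))))).trans_lt
      (h n))
  obtain ⟨g, hg, hgc⟩ := exists_bound (ι := ℕ) c (by simpa using aleph0_lt_boundingNumber)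
  refine hb ⟨range g, range_mem_infSets hg, fun x hx => ?_⟩
  obtain ⟨n, hn⟩ := mem_iUnion.1 (e ⟨x, hx⟩).2
  rw [leStar_iff, enum_range hg]
  filter_upwards [hcb n ⟨⟨x, hx⟩, hn⟩, hgc n] with k h1 h2 using h1.trans h2

theorem dominatingNumber_mem :
    dominatingNumber ∈ {κ | ∃ X : Set (Set ℕ), IsDominating X ∧ #X = κ} :=
  csInf_mem ⟨_, InfSets, ⟨subset_rfl, fun a ha => ⟨a, ha, by simp [LeStar]⟩⟩, rfl⟩

theorem boundingNumber_le_mk {X : Set (Set ℕ)} (hX : X ⊆ InfSets) (h : ¬ BoundedFor LeStar X) :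
    boundingNumber ≤ #X :=
  csInf_le (OrderBot.bddBelow _) ⟨X, hX, h, rfl⟩

/-! ### Semifilters -/

theorem IsSemifilter.mem_of_superset {S : Set (Set ℕ)} (hS : IsSemifilter S) {s t : Set ℕ}
    (hs : s ∈ S) (h : s ⊆ t) : t ∈ S :=
  hS.2 s hs t ((hS.1 hs).mono h) (by simp [sdiff_eq_empty.2 h])

theorem IsSemifilter.mem_of_eventually {S : Set (Set ℕ)} (hS : IsSemifilter S) {s t : Set ℕ}
    (hs : s ∈ S) (h : ∀ᶠ n in atTop, n ∈ s → n ∈ t) : t ∈ S := by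
  have hf : (s \ t).Finite := by
    rw [← Nat.cofinite_eq_atTop, eventually_cofinite] at h
    exact h.subset fun n hn => by simpa using hn
  refine hS.2 s hs t (fun ht => hS.1 hs ?_) hf
  exact (ht.union hf).subset fun n hn => by by_cases h : n ∈ t <;> simp [h, hn]

theorem not_leMod_of_lt {S : Set (Set ℕ)} (hS : IsSemifilter S) {a b : Set ℕ}
    (h : ∀ᶠ n in atTop, enum b n < enum a n) : ¬ LeMod S a b := fun h' => by
  refine hS.1 h' ?_
  rw [← Nat.cofinite_eq_atTop, eventually_cofinite] at h
  simpa [leSet] using h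

theorem exists_eventually_lt_of_isDominating {X : Set (Set ℕ)} (hX : IsDominating X) {c : Set ℕ}
    (hc : c ∈ InfSets) : ∃ x ∈ X, ∀ᶠ n in atTop, enum c n < enum x n := by
  have hg : StrictMono fun n => enum c n + 1 := (enum_strictMono hc).add_const 1
  obtain ⟨x, hx, h⟩ := hX.2 _ (range_mem_infSets hg)
  rw [leStar_iff, enum_range hg] at h
  exact ⟨x, hx, h⟩

theorem boundingNumberOf_le_dominatingNumber {S : Set (Set ℕ)} (hS : IsSemifilter S) :
    boundingNumberOf S ≤ dominatingNumber := by
  obtain ⟨X, hX, hc⟩ := dominatingNumber_mem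
  rw [← hc]
  refine csInf_le (OrderBot.bddBelow _) ⟨X, hX.1, ?_, rfl⟩
  rintro ⟨c, hc, h⟩
  obtain ⟨x, hx, hlt⟩ := exists_eventually_lt_of_isDominating hX hc
  exact not_leMod_of_lt hS hlt (h x hx)

theorem boundingNumber_le_boundingNumberOf {S : Set (Set ℕ)} (hS : IsSemifilter S)
    (hne : S.Nonempty) : boundingNumber ≤ boundingNumberOf S := by
  obtain ⟨D, hD, -⟩ := dominatingNumber_mem
  obtain ⟨s, hs⟩ := hne
  refine le_csInf ⟨_, D, hD.1, ?_, rfl⟩ ?_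
  · rintro ⟨c, hc, h⟩
    obtain ⟨x, hx, hlt⟩ := exists_eventually_lt_of_isDominating hD hc
    exact not_leMod_of_lt hS hlt (h x hx)
  rintro _ ⟨X, hX, hb, rfl⟩
  refine boundingNumber_le_mk hX fun ⟨c, hc, h⟩ => hb ⟨c, hc, fun x hx => ?_⟩
  exact hS.mem_of_eventually hs ((leStar_iff.1 (h x hx)).mono fun n hn _ => hn)

theorem boundingNumberOf_eq {S : Set (Set ℕ)} (hS : IsSemifilter S) (hne : S.Nonempty)
    (hbd : boundingNumber = dominatingNumber) : boundingNumberOf S = boundingNumber :=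
  le_antisymm (hbd ▸ boundingNumberOf_le_dominatingNumber hS)
    (boundingNumber_le_boundingNumberOf hS hne)

theorem IsCofinalScale.isScale {S X : Set (Set ℕ)} (hS : IsSemifilter S)
    (h : IsCofinalScale S X) : IsScale S X := by
  refine ⟨h.1, h.2.1, fun b hb => ⟨b, hb, ?_, h.2.2 b hb⟩⟩
  have e : leSet b b = Set.univ := by simp [leSet]
  rw [LeMod, e]
  exact ⟨infinite_univ, fun h' => hS.1 h' (by simp)⟩

/-! ### The Cantor topology on the power set -/

open Classical in
/-- The power set of `ℕ` is homeomorphic to the Cantor space. -/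
noncomputable def powerSetHomeomorph : Set ℕ ≃ₜ (ℕ → Bool) :=
  Equiv.toHomeomorphOfIsInducing
    { toFun := fun (a : Set ℕ) (n : ℕ) => (decide (n ∈ a) : Bool)
      invFun := fun f => {n | f n = true}
      left_inv := fun a => by ext; simp
      right_inv := fun f => by ext; simp }
    ⟨rfl⟩

theorem powerSetHomeomorph_apply {a : Set ℕ} {n : ℕ} : powerSetHomeomorph a n = true ↔ n ∈ a := by
  simp [powerSetHomeomorph]

instance : CompactSpace (Set ℕ) := powerSetHomeomorph.symm.compactSpace

instance : T2Space (Set ℕ) := powerSetHomeomorph.symm.t2Space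

instance : SecondCountableTopology (Set ℕ) := powerSetHomeomorph.secondCountableTopology

theorem isClopen_setOf_mem (n : ℕ) : IsClopen {a : Set ℕ | n ∈ a} := by
  have h : IsClopen {f : ℕ → Bool | f n = true} :=
    (isClopen_discrete {true}).preimage (continuous_apply n)
  convert h.preimage powerSetHomeomorph.continuous using 1
  ext a
  exact powerSetHomeomorph_apply.symm

theorem continuous_powerSet_iff {Z : Type*} [TopologicalSpace Z] {f : Z → Set ℕ} :
    Continuous f ↔ ∀ n, IsClopen {z | n ∈ f z} := by
  refine ⟨fun h n => (isClopen_setOf_mem n).preimage h, fun h => ?_⟩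
  rw [← powerSetHomeomorph.comp_continuous_iff, continuous_pi_iff]
  intro n
  rw [continuous_bool_rng true]
  convert h n using 1
  ext z
  exact powerSetHomeomorph_apply

theorem exists_forall_eq_below_mem {U : Set (Set ℕ)} (hU : IsOpen U) {x : Set ℕ} (hx : x ∈ U) :
    ∃ M : ℕ, ∀ y : Set ℕ, (∀ k < M, k ∈ y ↔ k ∈ x) → y ∈ U := by
  have hV : IsOpen (powerSetHomeomorph.symm ⁻¹' U) := hU.preimage powerSetHomeomorph.symm.continuous
  obtain ⟨I, u, hu, hI⟩ := isOpen_pi_iff.1 hV (powerSetHomeomorph x) (by simpa using hx)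
  refine ⟨I.sup id + 1, fun y hy => ?_⟩
  have : powerSetHomeomorph y ∈ powerSetHomeomorph.symm ⁻¹' U := hI fun k hk => by
    have e : powerSetHomeomorph y k = powerSetHomeomorph x k := by
      rw [Bool.eq_iff_iff, powerSetHomeomorph_apply, powerSetHomeomorph_apply]
      exact hy k (Nat.lt_succ_of_le (Finset.le_sup (f := id) hk))
    rw [e]
    exact (hu k hk).2
  simpa using this

theorem continuous_symmDiff_right (t : Set ℕ) : Continuous fun x : Set ℕ => symmDiff x t := by
  refine continuous_powerSet_iff.2 fun n => ?_
  by_cases h : n ∈ t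
  · simpa [mem_symmDiff, h] using
      (show IsClopen {x : Set ℕ | n ∉ x} from (isClopen_setOf_mem n).compl)
  · simpa [mem_symmDiff, h] using isClopen_setOf_mem n

/-- The homeomorphism of the power set given by the symmetric difference with a fixed set. -/
def symmDiffHomeomorph (t : Set ℕ) : Set ℕ ≃ₜ Set ℕ where
  toFun x := symmDiff x t
  invFun x := symmDiff x t
  left_inv x := symmDiff_symmDiff_cancel_right t x
  right_inv x := symmDiff_symmDiff_cancel_right t x
  continuous_toFun := continuous_symmDiff_right t
  continuous_invFun := continuous_symmDiff_right t

/-! ### Meager semifilters -/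

theorem isMeagre_setOf_eventually_nonempty {q : ℕ → ℕ} (hq : StrictMono q) :
    IsMeagre {x : Set ℕ | ∀ᶠ n in atTop, (x ∩ Ico (q n) (q (n + 1))).Nonempty} := by
  refine isMeagre_iff_countable_union_isNowhereDense.2
    ⟨range fun N : ℕ => {x : Set ℕ | ∀ n ≥ N, (x ∩ Ico (q n) (q (n + 1))).Nonempty}, ?_,
      countable_range _, ?_⟩
  · rintro _ ⟨N, rfl⟩
    have hc : IsClosed {x : Set ℕ | ∀ n ≥ N, (x ∩ Ico (q n) (q (n + 1))).Nonempty} := by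
      have : {x : Set ℕ | ∀ n ≥ N, (x ∩ Ico (q n) (q (n + 1))).Nonempty} =
          ⋂ n, ⋂ (_ : n ≥ N), ⋃ k ∈ Ico (q n) (q (n + 1)), {x : Set ℕ | k ∈ x} := by
        ext x
        simp only [mem_ofPred_eq, mem_iInter, mem_iUnion, Set.Nonempty, mem_inter_iff, exists_prop]
        exact forall₂_congr fun n _ => exists_congr fun k => and_comm
      rw [this]
      exact isClosed_iInter fun n => isClosed_iInter fun _ =>
        (finite_Ico _ _).isClosed_biUnion fun k _ => (isClopen_setOf_mem k).isClosed
    rw [hc.isNowhereDense_iff, eq_empty_iff_forall_notMem]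
    intro x hx
    obtain ⟨M, hM⟩ := exists_forall_eq_below_mem isOpen_interior hx
    have h := interior_subset (hM (x ∩ Iio M) fun k hk => by simp [hk])
    obtain ⟨k, ⟨-, h1⟩, h2, -⟩ := h (max M N) (le_max_right _ _)
    have h3 := hq.le_apply (x := max M N)
    have h4 : k < M := h1
    have := le_max_left M N
    omega
  · intro x hx
    obtain ⟨N, hN⟩ := eventually_atTop.1 hx
    exact ⟨_, ⟨N, rfl⟩, hN⟩

theorem exists_frequently_disjoint {S : Set (Set ℕ)} (hS : ¬ IsMeagre S) {q : ℕ → ℕ}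
    (hq : StrictMono q) : ∃ s ∈ S, ∃ᶠ n in atTop, s ∩ Ico (q n) (q (n + 1)) = ∅ := by
  by_contra! h
  refine hS ((isMeagre_setOf_eventually_nonempty hq).mono fun s hs => ?_)
  simpa [not_frequently, nonempty_iff_ne_empty] using h s hs

/-- There are finitely many possible traces below `K`, so the translates of the dense open sets by
all of them still meet in a dense open set; a long enough block of one of its points works whatever
happens below `K`. -/
theorem exists_forall_eq_Ico_mem {O : ℕ → Set (Set ℕ)} (hO : ∀ i, IsOpen (O i))
    (hd : ∀ i, Dense (O i)) (n K : ℕ) : ∃ M > K, ∃ z : Set ℕ, ∀ x : Set ℕ,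
      (∀ k ∈ Ico K M, k ∈ x ↔ k ∈ z) → ∀ i ≤ n, x ∈ O i := by
  let P : Set (Set ℕ) := 𝒫 (Iio K)
  have hP : P.Finite := (finite_Iio K).finite_subsets
  let G : Set (Set ℕ) := ⋂ i ∈ Iic n, ⋂ t ∈ P, symmDiffHomeomorph t ⁻¹' O i
  have hGo : IsOpen G := (finite_Iic n).isOpen_biInter fun i _ =>
    hP.isOpen_biInter fun t _ => (hO i).preimage (symmDiffHomeomorph t).continuous
  have hGd : Dense G := dense_biInter_of_isOpen
    (fun i _ => hP.isOpen_biInter fun t _ => (hO i).preimage (symmDiffHomeomorph t).continuous)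
    (finite_Iic n).countable fun i _ => dense_biInter_of_isOpen
      (fun t _ => (hO i).preimage (symmDiffHomeomorph t).continuous) hP.countable
      fun t _ => (hd i).preimage (symmDiffHomeomorph t).isOpenMap
  obtain ⟨z, hz⟩ := hGd.nonempty
  obtain ⟨M, hM⟩ := exists_forall_eq_below_mem hGo hz
  refine ⟨max M (K + 1), by omega, z, fun x hx i hi => ?_⟩
  -- The set `x` is corrected to agree with `z` below `K`; membership in `G` allows the correction
  -- to be undone.
  have h1 : symmDiff x (symmDiff x z ∩ Iio K) ∈ G := hM _ fun k hk => by
    by_cases hkK : k < K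
    · by_cases h : k ∈ x <;> by_cases h' : k ∈ z <;> simp [mem_symmDiff, h, h', hkK]
    · have := hx k ⟨by omega, by omega⟩
      simpa [mem_symmDiff, hkK] using this
  have h2 := mem_iInter₂.1 (mem_iInter₂.1 h1 i hi) (symmDiff x z ∩ Iio K) inter_subset_right
  simpa [symmDiffHomeomorph, symmDiff_symmDiff_cancel_right] using h2

/-- A member of S missing infinitely many blocks could be enlarged by the generic pattern in each
missed block. The result stays in S by upward closure, yet lies in a comeager set disjoint from S.
-/
theorem exists_eventually_nonempty {S : Set (Set ℕ)} (hS : IsSemifilter S) (hm : IsMeagre S) :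
    ∃ f : ℕ → ℕ, StrictMono f ∧ f 0 = 0 ∧
      ∀ s ∈ S, ∀ᶠ n in atTop, (s ∩ Ico (f n) (f (n + 1))).Nonempty := by
  obtain ⟨𝒪, ho, hd, hc, hsub⟩ := mem_residual_iff.1 hm
  -- Adjoining the whole space ensures that there is something to enumerate.
  obtain ⟨O, hO⟩ := (hc.insert Set.univ).exists_eq_range (insert_nonempty _ _)
  have hOo : ∀ i, IsOpen (O i) := fun i => by
    rcases (hO ▸ mem_range_self i : O i ∈ insert Set.univ 𝒪) with h | h
    · rw [h]; exact isOpen_univ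
    · exact ho _ h
  have hOd : ∀ i, Dense (O i) := fun i => by
    rcases (hO ▸ mem_range_self i : O i ∈ insert Set.univ 𝒪) with h | h
    · rw [h]; exact dense_univ
    · exact hd _ h
  choose M hM z hz using exists_forall_eq_Ico_mem hOo hOd
  let f : ℕ → ℕ := fun n => Nat.rec 0 (fun n K => M n K) n
  have hf : ∀ n, f (n + 1) = M n (f n) := fun n => rfl
  have hfm : StrictMono f := strictMono_nat_of_lt_succ fun n => by rw [hf]; exact hM _ _
  refine ⟨f, hfm, rfl, fun s hs => ?_⟩
  by_contra hcon
  let J : Set ℕ := {n | s ∩ Ico (f n) (f (n + 1)) = ∅}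
  have hJ : ∃ᶠ n in atTop, n ∈ J := fun h => hcon (h.mono fun n hn => nonempty_iff_ne_empty.2 hn)
  let s' : Set ℕ := s ∪ ⋃ n ∈ J, z n (f n) ∩ Ico (f n) (f (n + 1))
  refine hsub (?_ : s' ∈ ⋂₀ 𝒪) (hS.mem_of_superset hs subset_union_left)
  intro U hU
  obtain ⟨i, rfl⟩ : U ∈ range O := hO ▸ mem_insert_of_mem _ hU
  obtain ⟨n, hin, hn⟩ := frequently_atTop.1 hJ i
  refine hz n (f n) s' (fun k hk => ?_) i hin
  rw [← hf] at hk
  constructor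
  · rintro (h | h)
    · exact absurd ⟨h, hk⟩ (eq_empty_iff_forall_notMem.1 hn k)
    · obtain ⟨m, -, h1, h2⟩ := mem_iUnion₂.1 h
      obtain rfl : m = n := by
        rcases lt_trichotomy m n with h | h | h
        · have := hfm.monotone (Nat.succ_le_of_lt h); have := h2.2; have := hk.1; simp at *; omega
        · exact h
        · have := hfm.monotone (Nat.succ_le_of_lt h); have := h2.1; have := hk.2; simp at *; omega
      exact h1
  · exact fun h => Or.inr (mem_iUnion₂.2 ⟨n, hn, h, hk⟩)

/-! ### Scales of meager semifilters -/

/-- Every function is bounded, on a common infinite set of arguments and up to finitely many of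
them, by all but fewer than `𝔟` elements of `X`. -/
def IsInfinitelyOftenScale (X : Set (Set ℕ)) : Prop :=
  X ⊆ InfSets ∧ ∀ b : ℕ → ℕ, ∃ I : Set ℕ, I.Infinite ∧
    #{x | x ∈ X ∧ ¬ ∀ᶠ n in atTop, n ∈ I → b n ≤ enum x n} < boundingNumber

theorem exists_mem_Ico_of_strictMono {f : ℕ → ℕ} (hf : StrictMono f) (h0 : f 0 = 0) (n : ℕ) :
    ∃ k, n ∈ Ico (f k) (f (k + 1)) := by
  have h : ∃ k, n < f (k + 1) := ⟨n, Nat.lt_of_succ_le hf.le_apply⟩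
  classical
  refine ⟨Nat.find h, ?_, Nat.find_spec h⟩
  rcases Nat.eq_zero_or_pos (Nat.find h) with h' | h'
  · rw [h', h0]; exact Nat.zero_le _
  · have := Nat.find_min h (m := Nat.find h - 1) (by omega)
    rwa [Nat.sub_add_cancel h', not_lt] at this

theorem IsScale.isInfinitelyOftenScale {S X : Set (Set ℕ)} (hS : IsSemifilter S)
    (hbd : boundingNumber = dominatingNumber) (hm : IsMeagre S) (hX : IsScale S X) :
    IsInfinitelyOftenScale X := by
  -- With S empty, every element of X would be exceptional, against |X| ≥ 𝔟(S).
  have hne : S.Nonempty := by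
    by_contra hne
    rw [not_nonempty_iff_eq_empty] at hne
    obtain ⟨c, -, -, h⟩ := hX.2.2 Set.univ infinite_univ
    refine absurd h (not_lt.2 (hX.2.1.trans (mk_le_mk_of_subset ?_)))
    exact fun x hx => ⟨hx, by simp [LeMod, hne]⟩
  obtain ⟨f, hf, hf0, hfS⟩ := exists_eventually_nonempty hS hm
  refine ⟨hX.1, fun b => ?_⟩
  obtain ⟨g, hg, hbg⟩ := exists_strictMono_ge b
  -- The shift by 2 leaves room for a witness `j` in block k + 1 when `n` is in block k: then n ≤ j
  -- < f(k + 2), so monotonicity carries the inequality at `j` to the argument f(k + 2).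
  have hg2 : StrictMono fun n => g (f (n + 2)) :=
    hg.comp (hf.comp (strictMono_id.add_const 2))
  obtain ⟨C, hC, hBC, hlt⟩ := hX.2.2 _ (range_mem_infSets hg2)
  let K : Set ℕ := {k | ∃ n ∈ Ico (f k) (f (k + 1)), g (f (n + 2)) ≤ enum C n}
  have hK : K.Infinite := by
    have h1 : (leSet (range fun n => g (f (n + 2))) C).Infinite := hBC.1
    intro hfin
    refine h1 ((hfin.biUnion fun k _ => finite_Ico (f k) (f (k + 1))).subset fun n hn => ?_)
    obtain ⟨k, hk⟩ := exists_mem_Ico_of_strictMono hf hf0 n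
    have hn' : g (f (n + 2)) ≤ enum C n := by
      have : enum _ n ≤ enum C n := hn
      rwa [enum_range hg2] at this
    exact mem_iUnion₂.2 ⟨k, ⟨n, hk, hn'⟩, hk⟩
  refine ⟨(fun k => f (k + 2)) '' K, hK.image ?_, ?_⟩
  · exact (hf.comp (strictMono_id.add_const 2)).injective.injOn
  rw [boundingNumberOf_eq hS hne hbd] at hlt
  refine (mk_le_mk_of_subset ?_).trans_lt hlt
  refine fun x hx => ⟨hx.1, fun hCx => hx.2 ?_⟩
  obtain ⟨N, hN⟩ := eventually_atTop.1 (hfS _ hCx)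
  filter_upwards [eventually_ge_atTop (f (N + 2))]
  rintro _ hn ⟨k, ⟨n, hn1, hn2⟩, rfl⟩
  have hk : N ≤ k := by simpa using hf.le_iff_le.1 hn
  obtain ⟨j, hj1, hj2⟩ := hN (k + 1) (by omega)
  have hCm := (enum_strictMono hC).monotone
  have hxm := (enum_strictMono (hX.1 hx.1)).monotone
  have hj1' : enum C j ≤ enum x j := hj1
  calc b (f (k + 2)) ≤ g (f (k + 2)) := hbg _
    _ ≤ g (f (n + 2)) :=
      hg.monotone (hf.monotone (Nat.add_le_add_right (hf.le_apply.trans hn1.1) 2))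
    _ ≤ enum C n := hn2
    _ ≤ enum C j := hCm (hn1.2.le.trans hj2.1)
    _ ≤ enum x j := hj1'
    _ ≤ enum x (f (k + 2)) := hxm hj2.2.le

theorem isClosed_setOf_ncard_le (m n : ℕ) : IsClosed {x : Set ℕ | (x ∩ Iio m).ncard ≤ n} := by
  have hfin : ∀ x : Set ℕ, (x ∩ Iio m).Finite := fun x => (finite_Iio m).inter_of_right x
  rw [← isOpen_compl_iff, isOpen_iff_mem_nhds]
  intro x hx
  have h : (⋂ k ∈ x ∩ Iio m, {y : Set ℕ | k ∈ y}) ∈ 𝓝 x :=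
    ((hfin x).isOpen_biInter fun k _ => (isClopen_setOf_mem k).isOpen).mem_nhds
      (mem_iInter₂.2 fun k hk => hk.1)
  refine mem_of_superset h fun y hy hy' => hx ?_
  have hxy : x ∩ Iio m ⊆ y ∩ Iio m := fun k hk => ⟨mem_iInter₂.1 hy k hk, hk.2⟩
  exact (ncard_le_ncard hxy (hfin y)).trans hy'

/-- The sets with at most `n` elements form a compact family, the decreasing intersection of the
closed families restricting only the part below B. The tube lemma gives a neighbourhood of it, and
compactness puts one of those families inside. -/
theorem exists_isOpen_of_card_le {W : Set (Set ℕ × ℝ)} (hW : IsOpen W) {d : ℝ}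
    (hd : ∀ s ∈ FinSets, (s, d) ∈ W) (n : ℕ) :
    ∃ B : ℕ, ∃ V : Set ℝ, IsOpen V ∧ d ∈ V ∧
      ∀ x : Set ℕ, (x ∩ Iio B).ncard ≤ n → ∀ y ∈ V, (x, y) ∈ W := by
  let T : ℕ → Set (Set ℕ) := fun B => {x | (x ∩ Iio B).ncard ≤ n}
  have hfin : ∀ (x : Set ℕ) B, (x ∩ Iio B).Finite := fun x B => (finite_Iio B).inter_of_right x
  have hTc : ∀ B, IsClosed (T B) := fun B => isClosed_setOf_ncard_le B n
  have hTa : Antitone T := fun B B' h x hx =>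
    (ncard_le_ncard (inter_subset_inter_right x (Iio_subset_Iio h)) (hfin x B')).trans hx
  have hK : ⋂ B, T B ⊆ FinSets := fun x hx => by
    by_contra hinf
    obtain ⟨t, htx, htc⟩ := Set.Infinite.exists_subset_card_eq hinf (n + 1)
    have h1 : (x ∩ Iio (t.sup id + 1)).ncard ≤ n := mem_iInter.1 hx _
    have h2 : (t : Set ℕ) ⊆ x ∩ Iio (t.sup id + 1) := fun k hk =>
      ⟨htx hk, Nat.lt_succ_of_le (Finset.le_sup (f := id) hk)⟩
    have := ncard_le_ncard h2 (hfin _ _)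
    rw [ncard_coe_finset] at this
    omega
  obtain ⟨u, V, hu, hV, hKu, hdV, huV⟩ := generalized_tube_lemma
    (isClosed_iInter hTc).isCompact (isCompact_singleton (x := d)) hW (by
      rintro ⟨s, _⟩ ⟨hs, rfl⟩
      exact hd s (hK hs))
  obtain ⟨B, hB⟩ := exists_subset_nhds_of_isCompact' hTa.directed_ge
    (fun B => (hTc B).isCompact) hTc fun x hx => hu.mem_nhds (hKu hx)
  exact ⟨B, V, hV, hdV rfl, fun x hx y hy => huV ⟨hB hx, hy⟩⟩

/-- The point is that `V` does not depend on `x`: `x` only selects an index `N`, past which its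
bound on the common set `I` holds. -/
theorem IsInfinitelyOftenScale.exists_isOpen {X : Set (Set ℕ)} (hX : IsInfinitelyOftenScale X)
    {W : Set (Set ℕ × ℝ)} (hW : IsOpen W) {D : Set ℝ} (hD : D.Countable)
    (hDW : ∀ s ∈ FinSets, ∀ d ∈ D, (s, d) ∈ W) :
    ∃ X' : Set (Set ℕ), #X' < boundingNumber ∧ ∃ V : ℕ → Set ℝ, (∀ N, IsOpen (V N) ∧ D ⊆ V N) ∧
      ∀ x ∈ X \ X', ∃ N, ∀ y ∈ V N, (x, y) ∈ W := by
  rcases D.eq_empty_or_nonempty with rfl | hne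
  · exact ⟨∅, by simpa using aleph0_pos.trans aleph0_lt_boundingNumber, fun _ => ∅, by simp,
      by simp⟩
  obtain ⟨d, rfl⟩ := hD.exists_eq_range hne
  choose B V hV hdV hBV using fun k n =>
    exists_isOpen_of_card_le hW (fun s hs => hDW s hs (d k) ⟨k, rfl⟩) n
  obtain ⟨b, hb⟩ := exists_bound_nat B
  obtain ⟨I, hI, hlt⟩ := hX.2 b
  -- Exceeding `k` makes `b` bound `B k` at this index; exceeding `N` puts it where `b ≤ x` is
  -- already valid on `I`.
  choose m hmI hm using fun k N => Set.Infinite.exists_gt hI (max k N)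
  refine ⟨_, hlt, fun N => ⋃ k, V k (m k N), fun N => ⟨isOpen_iUnion fun k => hV _ _, ?_⟩, ?_⟩
  · rintro _ ⟨k, rfl⟩
    exact mem_iUnion.2 ⟨k, hdV k _⟩
  · rintro x ⟨hx, hx'⟩
    have hev : ∀ᶠ n in atTop, n ∈ I → b n ≤ enum x n := by
      by_contra h
      exact hx' ⟨hx, h⟩
    obtain ⟨N, hN⟩ := eventually_atTop.1 hev
    refine ⟨N, fun y hy => ?_⟩
    obtain ⟨k, hk⟩ := mem_iUnion.1 hy
    have hmax := hm k N
    refine hBV k (m k N) x ((le_enum_iff (hX.1 hx)).1 ?_) y hk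
    exact (hb k _ (by omega)).trans (hN _ (by omega) (hmI k N))

/-! ### The Menger property of products -/

/-- A sequence of increasing families `U n` admits a choice of members that covers every point of
`A` infinitely often. -/
def IsCoveredOften {E : Type} (U : ℕ → ℕ → Set E) (A : Set E) : Prop :=
  ∃ f : ℕ → ℕ, ∀ z ∈ A, ∃ᶠ n in atTop, z ∈ U n (f n)

section Covers

variable {E : Type} {U : ℕ → ℕ → Set E} {A : Set E}

theorem IsCoveredOften.mono {B : Set E} (hB : IsCoveredOften U B) (h : A ⊆ B) :
    IsCoveredOften U A :=
  hB.imp fun _ hf z hz => hf z (h hz)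

/-- Covering infinitely often, rather than once, survives passage to an eventual upper bound of the
choice functions. -/
theorem IsCoveredOften.iUnion (hU : ∀ n, Monotone (U n)) {ι : Type} (hι : #ι < boundingNumber)
    {A : ι → Set E} (hA : ∀ i, IsCoveredOften U (A i)) : IsCoveredOften U (⋃ i, A i) := by
  choose f hf using hA
  obtain ⟨g, -, hg⟩ := exists_bound f hι
  refine ⟨g, fun z hz => ?_⟩
  obtain ⟨i, hi⟩ := mem_iUnion.1 hz
  exact ((hf i z hi).and_eventually (hg i)).mono fun n hn => hU n hn.2 hn.1

theorem IsCoveredOften.union (hU : ∀ n, Monotone (U n)) {B : Set E} (hA : IsCoveredOften U A)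
    (hB : IsCoveredOften U B) : IsCoveredOften U (A ∪ B) := by
  rw [union_eq_iUnion]
  exact IsCoveredOften.iUnion hU ((lt_aleph0_of_finite _).trans aleph0_lt_boundingNumber)
    (by rintro (_ | _) <;> assumption)

theorem exists_eventually_mem (hU : ∀ n, Monotone (U n)) (hA : ∀ n, A ⊆ ⋃ m, U n m)
    (hlt : #A < boundingNumber) : ∃ f : ℕ → ℕ, ∀ z ∈ A, ∀ᶠ n in atTop, z ∈ U n (f n) := by
  choose φ hφ using fun (z : A) n => mem_iUnion.1 (hA n z.2)
  obtain ⟨g, -, hg⟩ := exists_bound φ hlt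
  exact ⟨g, fun z hz => (hg ⟨z, hz⟩).mono fun n hn => hU n hn (hφ ⟨z, hz⟩ n)⟩

theorem IsCoveredOften.of_card_diff_lt (hU : ∀ n, Monotone (U n)) (hA : ∀ n, A ⊆ ⋃ m, U n m)
    (f : ℕ → ℕ) (h : ∀ N, #(A \ ⋃ n ≥ N, U n (f n) : Set E) < boundingNumber) :
    IsCoveredOften U A := by
  have h1 : IsCoveredOften U (⋃ N, A \ ⋃ n ≥ N, U n (f n)) := by
    obtain ⟨g, hg⟩ := exists_eventually_mem hU
      (fun n => (iUnion_subset fun N => sdiff_subset).trans (hA n)) (mk_iUnion_lt_boundingNumber h)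
    exact ⟨g, fun z hz => (hg z hz).frequently⟩
  have h2 : IsCoveredOften U (⋂ N : ℕ, ⋃ n ≥ N, U n (f n)) :=
    ⟨f, fun z hz => frequently_atTop.2 fun N => by simpa using mem_iInter.1 hz N⟩
  refine (h1.union hU h2).mono fun z hz => ?_
  by_cases hz' : ∀ N : ℕ, z ∈ ⋃ n ≥ N, U n (f n)
  · exact Or.inr (mem_iInter.2 hz')
  · obtain ⟨N, hN⟩ := not_forall.1 hz'
    exact Or.inl (mem_iUnion.2 ⟨N, hz, hN⟩)

theorem subset_iUnion_of_eventually_mem {f : ℕ → ℕ} {z : E}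
    (h : ∀ᶠ n in atTop, z ∈ U n (f n)) (N : ℕ) : z ∈ ⋃ n ≥ N, U n (f n) := by
  obtain ⟨n, h1, h2⟩ := (h.and (eventually_ge_atTop N)).exists
  exact mem_iUnion₂.2 ⟨n, h2, h1⟩

theorem mk_lt_boundingNumber_of_countable (hA : A.Countable) : #A < boundingNumber :=
  (mk_le_aleph0_iff.2 hA).trans_lt aleph0_lt_boundingNumber

end Covers

theorem countable_finSets : FinSets.Countable := Countable.ofPred_finite

theorem IsInfinitelyOftenScale.isCoveredOften_prod {X : Set (Set ℕ)}
    (hX : IsInfinitelyOftenScale X) {Y D : Set ℝ} (hD : D.Countable) (hDY : D ⊆ Y)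
    (hY : ∀ V : Set ℝ, IsOpen V → D ⊆ V → #(Y \ V : Set ℝ) < boundingNumber)
    {U : ℕ → ℕ → Set (Set ℕ × ℝ)} (ho : ∀ n m, IsOpen (U n m)) (hU : ∀ n, Monotone (U n))
    (hc : ∀ n, (X ∪ FinSets) ×ˢ Y ⊆ ⋃ m, U n m) :
    IsCoveredOften U ((X ∪ FinSets) ×ˢ Y) := by
  have hWo : ∀ (f : ℕ → ℕ) (N : ℕ), IsOpen (⋃ n ≥ N, U n (f n)) := fun f N =>
    isOpen_biUnion fun n _ => ho _ _
  have hvert : ∀ x ∈ X ∪ FinSets, IsCoveredOften U ({x} ×ˢ Y) := fun x hx => by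
    obtain ⟨f, hf⟩ := exists_eventually_mem (A := {x} ×ˢ D) hU
      (fun n => (prod_mono (singleton_subset_iff.2 hx) hDY).trans (hc n))
      (mk_lt_boundingNumber_of_countable ((countable_singleton x).prod hD))
    refine .of_card_diff_lt hU
      (fun n => (prod_mono_left (singleton_subset_iff.2 hx)).trans (hc n)) f fun N => ?_
    have h := hY {y | (x, y) ∈ ⋃ n ≥ N, U n (f n)}
      ((hWo f N).preimage (Continuous.prodMk_right x))
      fun d hd => subset_iUnion_of_eventually_mem (hf (x, d) ⟨rfl, hd⟩) N
    refine ((mk_le_mk_of_subset ?_).trans (mk_image_le (f := Prod.mk x))).trans_lt h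
    rintro ⟨_, y⟩ ⟨⟨rfl, hy⟩, h'⟩
    exact ⟨y, ⟨hy, h'⟩, rfl⟩
  have hhor : ∀ y ∈ Y, IsCoveredOften U ((X ∪ FinSets) ×ˢ {y}) := fun y hy => by
    obtain ⟨f, hf⟩ := exists_eventually_mem (A := FinSets ×ˢ {y}) hU
      (fun n => (prod_mono subset_union_right (singleton_subset_iff.2 hy)).trans (hc n))
      (mk_lt_boundingNumber_of_countable (countable_finSets.prod (countable_singleton y)))
    refine .of_card_diff_lt hU
      (fun n => (prod_mono_right (singleton_subset_iff.2 hy)).trans (hc n)) f fun N => ?_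
    have hFW : ∀ s ∈ FinSets, ∀ d ∈ ({y} : Set ℝ), (s, d) ∈ ⋃ n ≥ N, U n (f n) :=
      fun s hs d hd => subset_iUnion_of_eventually_mem (hf (s, d) ⟨hs, hd⟩) N
    obtain ⟨X', hX', V, hV, hXV⟩ := hX.exists_isOpen (hWo f N) (countable_singleton y) hFW
    refine ((mk_le_mk_of_subset ?_).trans (mk_image_le (f := fun x => (x, y)))).trans_lt hX'
    rintro ⟨x, _⟩ ⟨⟨hx, rfl⟩, h'⟩
    refine ⟨x, ?_, rfl⟩
    by_contra hxX
    rcases hx with hx | hx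
    · obtain ⟨M, hM⟩ := hXV x ⟨hx, hxX⟩
      exact h' (hM _ ((hV M).2 rfl))
    · exact h' (hFW x hx _ rfl)
  obtain ⟨f, hf⟩ := exists_eventually_mem (A := FinSets ×ˢ D) hU
    (fun n => (prod_mono subset_union_right hDY).trans (hc n))
    (mk_lt_boundingNumber_of_countable (countable_finSets.prod hD))
  choose X' hX' V hV hXV using fun N => hX.exists_isOpen (hWo f N) hD
    fun s hs d hd => subset_iUnion_of_eventually_mem (hf (s, d) ⟨hs, hd⟩) N
  -- The exceptional first and second coordinates number fewer than 𝔟 each; their slices are covered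
  -- separately, and `f` itself handles the remaining rectangle.
  have hXb : #(⋃ N, X' N) < boundingNumber := mk_iUnion_lt_boundingNumber hX'
  have hYb : #(⋃ N, ⋃ M, Y \ V N M) < boundingNumber := mk_iUnion_lt_boundingNumber fun N =>
    mk_iUnion_lt_boundingNumber fun M => hY _ (hV N M).1 (hV N M).2
  have h1 : IsCoveredOften U (⋃ x : FinSets, {x.1} ×ˢ Y) :=
    .iUnion hU (mk_lt_boundingNumber_of_countable countable_finSets) fun x => hvert x (Or.inr x.2)
  have h2 : IsCoveredOften U (⋃ x : (X ∩ ⋃ N, X' N : Set (Set ℕ)), {x.1} ×ˢ Y) :=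
    .iUnion hU ((mk_le_mk_of_subset inter_subset_right).trans_lt hXb)
      fun x => hvert x (Or.inl x.2.1)
  have h3 : IsCoveredOften U (⋃ y : (Y ∩ ⋃ N, ⋃ M, Y \ V N M : Set ℝ), (X ∪ FinSets) ×ˢ {y.1}) :=
    .iUnion hU ((mk_le_mk_of_subset inter_subset_right).trans_lt hYb) fun y => hhor y y.2.1
  have h4 : IsCoveredOften U ((X \ ⋃ N, X' N) ×ˢ (Y \ ⋃ N, ⋃ M, Y \ V N M)) := by
    refine ⟨f, ?_⟩
    rintro ⟨x, y⟩ ⟨⟨hx, hx'⟩, hy, hy'⟩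
    refine frequently_atTop.2 fun N => ?_
    obtain ⟨M, hM⟩ := hXV N x ⟨hx, fun h => hx' (mem_iUnion.2 ⟨N, h⟩)⟩
    have hyV : y ∈ V N M := by
      by_contra h
      exact hy' (mem_iUnion₂.2 ⟨N, M, hy, h⟩)
    simpa using hM y hyV
  refine (((h1.union hU h2).union hU h3).union hU h4).mono ?_
  rintro ⟨x, y⟩ ⟨hx, hy⟩
  by_cases hxF : x ∈ FinSets
  · exact Or.inl (Or.inl (Or.inl (mem_iUnion.2 ⟨⟨x, hxF⟩, rfl, hy⟩)))
  replace hx := hx.resolve_right hxF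
  by_cases hxb : x ∈ ⋃ N, X' N
  · exact Or.inl (Or.inl (Or.inr (mem_iUnion.2 ⟨⟨x, hx, hxb⟩, rfl, hy⟩)))
  by_cases hyb : y ∈ ⋃ N, ⋃ M, Y \ V N M
  · exact Or.inl (Or.inr (mem_iUnion.2 ⟨⟨y, hy, hyb⟩, Or.inl hx, rfl⟩))
  · exact Or.inr ⟨⟨hx, hxb⟩, hy, hyb⟩

theorem isMenger_of_isInducing {T E : Type} [TopologicalSpace T] [TopologicalSpace E]
    [SecondCountableTopology T] {π : T → E} (hπ : IsInducing π)
    (h : ∀ U : ℕ → ℕ → Set E, (∀ n m, IsOpen (U n m)) → (∀ n, Monotone (U n)) →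
      (∀ n, range π ⊆ ⋃ m, U n m) → IsCoveredOften U (range π)) : IsMenger T := by
  intro 𝒰 h𝒰
  rcases isEmpty_or_nonempty T with hT | ⟨⟨t₀⟩⟩
  · exact ⟨fun _ => ∅, by simp, Subsingleton.elim _ _⟩
  have hex : ∀ n, ∃ O : ℕ → Set E, (∀ m, IsOpen (O m) ∧ π ⁻¹' O m ∈ 𝒰 n) ∧
      range π ⊆ ⋃ m, O m := fun n => by
    obtain ⟨c, hc, hcU, hcu⟩ := TopologicalSpace.isOpen_sUnion_countable (𝒰 n) (h𝒰 n).1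
    rw [(h𝒰 n).2] at hcu
    have hne : c.Nonempty := by
      obtain ⟨V, hV, -⟩ : t₀ ∈ ⋃₀ c := hcu ▸ mem_univ t₀
      exact ⟨V, hV⟩
    obtain ⟨e, rfl⟩ := hc.exists_eq_range hne
    choose O hO hOe using fun m => hπ.isOpen_iff.1 ((h𝒰 n).1 _ (hcU ⟨m, rfl⟩))
    refine ⟨O, fun m => ⟨hO m, hOe m ▸ hcU ⟨m, rfl⟩⟩, ?_⟩
    rintro _ ⟨t, rfl⟩
    obtain ⟨_, ⟨m, rfl⟩, hm⟩ : t ∈ ⋃₀ range e := hcu ▸ mem_univ t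
    rw [← hOe m] at hm
    exact mem_iUnion.2 ⟨m, hm⟩
  choose O hO hOc using hex
  obtain ⟨f, hf⟩ := h (fun n m => ⋃ k ≤ m, O n k)
    (fun n m => isOpen_biUnion fun k _ => (hO n k).1)
    (fun n m m' hm => biUnion_subset_biUnion_left fun k hk => le_trans hk hm)
    (fun n => (hOc n).trans (iUnion_mono fun m => subset_biUnion_of_mem (u := O n)
      (mem_Iic.2 le_rfl : m ∈ Iic m)))
  refine ⟨fun n => (fun k => π ⁻¹' O n k) '' Iic (f n), fun n => ⟨?_, (finite_Iic _).image _⟩, ?_⟩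
  · rintro _ ⟨k, -, rfl⟩
    exact (hO n k).2
  · refine eq_univ_of_forall fun t => ?_
    obtain ⟨n, hn⟩ := (hf _ ⟨t, rfl⟩).exists
    obtain ⟨k, hk, hk'⟩ := mem_iUnion₂.1 hn
    exact ⟨_, mem_iUnion.2 ⟨n, k, hk, rfl⟩, hk'⟩

theorem IsScale.isMenger_prod {S X : Set (Set ℕ)} (hS : IsSemifilter S)
    (hbd : boundingNumber = dominatingNumber) (hm : IsMeagre S) (hX : IsScale S X)
    {Y : Set ℝ} (hY : IsConcentrated dominatingNumber Y) :
    IsMenger (↥(X ∪ FinSets) × Y) := by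
  obtain ⟨-, D, hD, hDY⟩ := hY
  have hπ : IsInducing (Prod.map Subtype.val Subtype.val : ↥(X ∪ FinSets) × Y → Set ℕ × ℝ) :=
    IsInducing.subtypeVal.prodMap IsInducing.subtypeVal
  refine isMenger_of_isInducing hπ fun U ho hU hc => ?_
  rw [range_prodMap, Subtype.range_val, Subtype.range_val] at hc ⊢
  refine (hX.isInfinitelyOftenScale hS hbd hm).isCoveredOften_prod (D := Subtype.val '' D)
    (hD.image _) (Subtype.coe_image_subset _ _) (fun V hV hDV => ?_) ho hU hc
  rw [hbd]
  refine lt_of_le_of_lt ((mk_le_mk_of_subset ?_).trans (mk_image_le (f := Subtype.val)))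
    (hDY (Subtype.val ⁻¹' V) (hV.preimage continuous_subtype_val) (image_subset_iff.1 hDV))
  exact fun y hy => ⟨⟨y, hy.1⟩, hy.2, rfl⟩

/-! ### Construction of a cofinal scale -/

/-- A dominating family is well-ordered in type 𝔟 and `h α` is taken to bound its members up to α,
so a function dominated by the β-th member can fail only at α < β. -/
theorem exists_dominating_family (hbd : boundingNumber = dominatingNumber) :
    ∃ (I : Type) (h : I → ℕ → ℕ), (∀ α, StrictMono (h α)) ∧ boundingNumber ≤ #I ∧
      ∀ f : ℕ → ℕ, #{α | ¬ ∀ᶠ n in atTop, f n ≤ h α n} < boundingNumber := by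
  obtain ⟨D, hD, hc⟩ := dominatingNumber_mem
  rw [← hbd] at hc
  have hI : #(boundingNumber.ord.ToType) = #D := by rw [mk_ord_toType, hc]
  obtain ⟨e⟩ := Cardinal.eq.1 hI
  have hIio : ∀ α : boundingNumber.ord.ToType, #(Iio α) < boundingNumber :=
    fun α => by
    simpa using mk_Iio_lt α (by simp)
  have hIic : ∀ α : boundingNumber.ord.ToType, #(Iic α) < boundingNumber := fun α => by
    rw [← Iio_insert]
    exact mk_insert_le.trans_lt (add_lt_of_lt aleph0_lt_boundingNumber.le (hIio α)
      (one_lt_aleph0.trans aleph0_lt_boundingNumber))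
  choose h hh hbound using fun α => exists_bound (fun β : Iic α => enum (e β)) (hIic α)
  refine ⟨_, h, hh, (mk_ord_toType _).ge, fun f => ?_⟩
  obtain ⟨g, hg, hfg⟩ := exists_strictMono_ge f
  obtain ⟨x, hx, hgx⟩ := hD.2 _ (range_mem_infSets hg)
  rw [leStar_iff, enum_range hg] at hgx
  obtain ⟨β, hβ⟩ := e.surjective ⟨x, hx⟩
  refine (mk_le_mk_of_subset ?_).trans_lt (hIio β)
  intro α hα
  by_contra hβα
  refine hα ?_
  filter_upwards [hgx, hbound α ⟨β, mem_Iic.2 (not_lt.1 hβα)⟩] with n h1 h2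
  rw [hβ] at h2
  exact (hfg n).trans (h1.trans h2)

/-- With q growing faster than `h`, some s ∈ S misses infinitely many blocks [q(2n), q(2n+2)). The
right halves of the missed blocks make up x. For j ∈ s, whose block is not missed, x has no point in
[j, h(j)), so x(j) ≥ h(j). The block endpoints q(2n+2) make up p. -/
theorem exists_sparse_pair {S : Set (Set ℕ)} (hS : IsSemifilter S) (hm : ¬ IsMeagre S) {h : ℕ → ℕ}
    (hh : StrictMono h) : ∃ x p : Set ℕ, x ∈ InfSets ∧ p ∈ InfSets ∧ Disjoint x p ∧
      {n | h n ≤ enum x n} ∈ S ∧ (∀ n, h n ≤ enum p n) ∧ ∃ᶠ a in atTop, Ico a (h a) ⊆ x := by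
  obtain ⟨q, hq0, hq1⟩ : ∃ q : ℕ → ℕ, q 0 = 0 ∧ ∀ n, q (n + 1) = h (q n) + 1 :=
    ⟨fun n => Nat.rec 0 (fun _ K => h K + 1) n, rfl, fun n => rfl⟩
  have hq : StrictMono q := strictMono_nat_of_lt_succ fun n => by
    rw [hq1]; exact Nat.lt_succ_of_le hh.le_apply
  have hq2 : StrictMono fun n => q (2 * n) := fun a b hab =>
    hq (show 2 * a < 2 * b by omega)
  have hp : StrictMono fun n => q (2 * n + 2) := fun a b hab =>
    hq (show 2 * a + 2 < 2 * b + 2 by omega)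
  obtain ⟨s, hs, hsq⟩ := exists_frequently_disjoint hm hq2
  let A : Set ℕ := {n | s ∩ Ico (q (2 * n)) (q (2 * (n + 1))) = ∅}
  let x : Set ℕ := ⋃ n ∈ A, Ico (q (2 * n + 1)) (q (2 * n + 2))
  have hAx : ∀ n ∈ A, Ico (q (2 * n + 1)) (h (q (2 * n + 1))) ⊆ x := fun n hn k hk =>
    mem_iUnion₂.2 ⟨n, hn, hk.1, hk.2.trans (hq1 (2 * n + 1) ▸ Nat.lt_succ_self _)⟩
  have hfreq : ∃ᶠ a in atTop, Ico a (h a) ⊆ x ∧ a ∈ x := by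
    refine frequently_atTop.2 fun N => ?_
    obtain ⟨n, hn, hnA⟩ := frequently_atTop.1 hsq N
    refine ⟨q (2 * n + 1), ?_, hAx n hnA, mem_iUnion₂.2 ⟨n, hnA, le_rfl, hq (by omega)⟩⟩
    have := hq.le_apply (x := 2 * n + 1)
    omega
  have hxinf : x ∈ InfSets :=
    Nat.frequently_atTop_iff_infinite.1 (hfreq.mono fun a ha => ha.2)
  refine ⟨x, range fun n => q (2 * n + 2), hxinf, range_mem_infSets hp, ?_, ?_, ?_,
    hfreq.mono fun a ha => ha.1⟩
  · rw [disjoint_left]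
    rintro _ hx ⟨m, rfl⟩
    obtain ⟨n, -, h1, h2⟩ := mem_iUnion₂.1 hx
    have h1' : 2 * n + 1 ≤ 2 * m + 2 := hq.le_iff_le.1 h1
    have h2' : 2 * m + 2 < 2 * n + 2 := hq.lt_iff_lt.1 h2
    omega
  · refine hS.mem_of_superset hs fun j hj => ?_
    obtain ⟨m, hm1, hm2⟩ := exists_mem_Ico_of_strictMono hq2 hq0 j
    have hmA : m ∉ A := fun hmA => eq_empty_iff_forall_notMem.1 hmA j ⟨hj, hm1, hm2⟩
    refine (le_enum_iff hxinf).2 ?_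
    have hsub : x ∩ Iio (h j) ⊆ Iio j := by
      rintro k ⟨hk, hkj⟩
      obtain ⟨n, hn, h1, h2⟩ := mem_iUnion₂.1 hk
      have h3 : q (2 * n + 1) < q (2 * m + 3) := calc
        q (2 * n + 1) ≤ k := h1
        _ < h j := hkj
        _ < h (q (2 * m + 2)) := hh hm2
        _ < q (2 * m + 3) := hq1 (2 * m + 2) ▸ Nat.lt_succ_self _
      have h4 := hq.lt_iff_lt.1 h3
      have h5 : n ≠ m := fun e => hmA (e ▸ hn)
      have h6 : q (2 * n + 2) ≤ q (2 * m) := hq.monotone (by omega)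
      exact h2.trans_le (h6.trans hm1)
    calc (x ∩ Iio (h j)).ncard ≤ (Iio j).ncard := ncard_le_ncard hsub (finite_Iio j)
      _ = j := by rw [← Finset.coe_Iio, ncard_coe_finset, Nat.card_Iio]
  · intro n
    rw [enum_range hp]
    have h1 : n ≤ q (2 * n + 1) := le_trans (by omega) (hq.le_apply (x := 2 * n + 1))
    exact (hh.monotone h1).trans ((Nat.le_succ _).trans (hq1 (2 * n + 1)).ge)

/-! ### A concentrated set with a product that is not Menger -/

/-- For fixed a, the closed conditions on [a, m) shrink, as m grows, to a set of (cofinite, finite)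
pairs; compactness gives an m that suffices. -/
theorem exists_Ico_imp_mem {U : Set (Set ℕ × Set ℕ)} (hU : IsOpen U)
    (hUQ : ∀ u p : Set ℕ, uᶜ.Finite → p.Finite → (u, p) ∈ U) :
    ∃ g : ℕ → ℕ, ∀ u p : Set ℕ, ∀ a, Ico a (g a) ⊆ u → Disjoint (Ico a (g a)) p → (u, p) ∈ U := by
  suffices h : ∀ a, ∃ m, ∀ u p : Set ℕ, Ico a m ⊆ u → Disjoint (Ico a m) p → (u, p) ∈ U by
    choose g hg using h
    exact ⟨g, fun u p a => hg a u p⟩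
  intro a
  let T : ℕ → Set (Set ℕ × Set ℕ) := fun m => {z | ∀ k ∈ Ico a m, k ∈ z.1 ∧ k ∉ z.2}
  have hTc : ∀ m, IsClosed (T m) := fun m => by
    have : T m = ⋂ k ∈ Ico a m, {z : Set ℕ × Set ℕ | k ∈ z.1} ∩ {z : Set ℕ × Set ℕ | k ∈ z.2}ᶜ := by
      ext z; simp [T]
    rw [this]
    exact isClosed_biInter fun k _ =>
      (((isClopen_setOf_mem k).preimage continuous_fst).inter
        ((isClopen_setOf_mem k).preimage continuous_snd).compl).isClosed
  have hTa : Antitone T := fun m m' hmm z hz k hk => hz k ⟨hk.1, hk.2.trans_le hmm⟩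
  obtain ⟨m, hm⟩ := exists_subset_nhds_of_isCompact' hTa.directed_ge
    (fun m => (hTc m).isCompact) hTc (U := U) (by
      rintro ⟨u, p⟩ hz
      have hz' : ∀ k ≥ a, k ∈ u ∧ k ∉ p := fun k hk =>
        mem_iInter.1 hz (k + 1) k ⟨hk, Nat.lt_succ_self k⟩
      refine hU.mem_nhds (hUQ u p ((finite_Iio a).subset fun k hk => ?_)
        ((finite_Iio a).subset fun k hk => ?_))
      · exact not_le.1 fun h => hk (hz' k h).1
      · exact not_le.1 fun h => (hz' k h).2 hk)
  exact ⟨m, fun u p hu hp => hm fun k hk => ⟨hu hk, disjoint_left.1 hp hk⟩⟩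

theorem not_isMenger_of_continuous {Z : Type} [TopologicalSpace Z] {F : Z → Set ℕ}
    (hF : Continuous F) (hinf : ∀ z, F z ∈ InfSets)
    (hdom : ∀ f : ℕ → ℕ, ∃ z, ∀ᶠ n in atTop, f n ≤ enum (F z) n) : ¬ IsMenger Z := by
  intro hM
  let V : ℕ → ℕ → Set Z := fun n m => {z | enum (F z) n < m}
  have hV : ∀ n, IsOpenCover Z (range (V n)) := fun n => by
    refine ⟨?_, eq_univ_of_forall fun z =>
      ⟨_, ⟨enum (F z) n + 1, rfl⟩, Nat.lt_succ_self _⟩⟩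
    rintro _ ⟨m, rfl⟩
    have : V n m = (F ⁻¹' {x : Set ℕ | (x ∩ Iio m).ncard ≤ n})ᶜ := by
      ext z
      exact not_le.symm.trans (not_congr (le_enum_iff (hinf z)))
    rw [this]
    exact ((isClosed_setOf_ncard_le m n).preimage hF).isOpen_compl
  -- Menger's property is applied to every tail of the sequence of covers, because domination holds
  -- only from some `N` on.
  have hN : ∀ N : ℕ, ∃ f : ℕ → ℕ, ∀ z, ∃ n, enum (F z) (N + n) < f n := fun N => by
    obtain ⟨ℱ, hℱ, hcov⟩ := hM (fun n => range (V (N + n))) fun n => hV _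
    have hb : ∀ n, ∃ m, ∀ W ∈ ℱ n, W ⊆ V (N + n) m := fun n => by
      choose! k hk using fun W (hW : W ∈ ℱ n) => (hℱ n).1 hW
      obtain ⟨m, hm⟩ := ((hℱ n).2.image k).bddAbove
      refine ⟨m, fun W hW z hz => ?_⟩
      rw [← hk W hW] at hz
      exact lt_of_lt_of_le hz (hm ⟨W, hW, rfl⟩)
    choose f hf using hb
    refine ⟨f, fun z => ?_⟩
    obtain ⟨W, hW, hz⟩ : z ∈ ⋃₀ (⋃ n, ℱ n) := hcov ▸ mem_univ z
    obtain ⟨n, hn⟩ := mem_iUnion.1 hW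
    exact ⟨n, hf n W hn hz⟩
  choose f hf using hN
  obtain ⟨g, hg⟩ := exists_bound_nat fun N k => f N (k - N)
  obtain ⟨z, hz⟩ := hdom g
  obtain ⟨N, hN⟩ := eventually_atTop.1 hz
  obtain ⟨n, hn⟩ := hf N z
  have h1 := hg N (N + n) (by omega)
  have h2 := hN (N + n) (by omega)
  simp only [Nat.add_sub_cancel_left] at h1
  omega

theorem exists_isEmbedding_real : ∃ ψ : Set ℕ × Set ℕ → ℝ, IsEmbedding ψ := by
  let e : Set ℕ × Set ℕ ≃ₜ cantorSet :=
    (powerSetHomeomorph.prodCongr powerSetHomeomorph).trans <|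
      Homeomorph.sumArrowHomeomorphProdArrow.symm.trans <|
        (Homeomorph.piCongrLeft (Y := fun _ => Bool) Equiv.natSumNatEquivNat).trans
          cantorSetHomeomorphNatToBool.symm
  exact ⟨fun z => e z, IsEmbedding.subtypeVal.comp e.isEmbedding⟩

theorem exists_isCofinalScale_not_isMenger {S : Set (Set ℕ)} (hS : IsSemifilter S)
    (hbd : boundingNumber = dominatingNumber) (hm : ¬ IsMeagre S) :
    ∃ X : Set (Set ℕ), IsCofinalScale S X ∧ ∃ Y : Set ℝ, IsConcentrated dominatingNumber Y ∧
      ¬ IsMenger (↥(X ∪ FinSets) × Y) := by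
  have hne : S.Nonempty := by
    by_contra hne
    rw [not_nonempty_iff_eq_empty] at hne
    exact hm (hne ▸ IsMeagre.empty)
  obtain ⟨I, h, hh, hI, hbad⟩ := exists_dominating_family hbd
  choose x p hx hp hxp hxS hph hxh using fun α => exists_sparse_pair hS hm (hh α)
  have hdom : ∀ f : ℕ → ℕ, ∃ α, ∀ᶠ n in atTop, f n ≤ h α n := fun f => by
    by_contra hcon
    rw [not_exists] at hcon
    refine absurd (hbad f) (not_lt.2 (hI.trans ?_))
    rw [eq_univ_of_forall (s := {α | ¬ ∀ᶠ n in atTop, f n ≤ h α n}) hcon, mk_univ]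
  have hXc : boundingNumber ≤ #(range x) := by
    refine boundingNumber_le_mk (range_subset_iff.2 hx) ?_
    rintro ⟨c, -, hcx⟩
    obtain ⟨α, hα⟩ := hdom fun n => enum c n + 1
    refine hS.1 (hxS α) ?_
    rw [← not_infinite, ← Nat.frequently_atTop_iff_infinite, not_frequently]
    filter_upwards [hα, leStar_iff.1 (hcx _ ⟨α, rfl⟩)] with n h1 h2 h3
    have h4 : h α n ≤ enum (x α) n := h3
    omega
  refine ⟨range x, ⟨range_subset_iff.2 hx, (boundingNumberOf_eq hS hne hbd).trans_le hXc,
    fun b _ => ?_⟩, ?_⟩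
  · rw [boundingNumberOf_eq hS hne hbd]
    refine ((mk_le_mk_of_subset ?_).trans (mk_image_le (f := x))).trans_lt (hbad (enum b))
    rintro _ ⟨⟨α, rfl⟩, hα⟩
    refine ⟨α, fun hev => hα (hS.mem_of_eventually (hxS α) ?_), rfl⟩
    exact hev.mono fun n h1 h2 => le_trans h1 h2
  obtain ⟨ψ, hψ⟩ := exists_isEmbedding_real
  let Q : Set (Set ℕ × Set ℕ) := {u | uᶜ.Finite} ×ˢ FinSets
  have hQ : Q.Countable := by
    refine Countable.prod ?_ countable_finSets
    have hsub : {u : Set ℕ | uᶜ.Finite} ⊆ compl '' FinSets := fun u hu =>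
      ⟨uᶜ, hu, compl_compl u⟩
    exact (countable_finSets.image compl).mono hsub
  let Y₀ : Set (Set ℕ × Set ℕ) := range (fun α => (x α, p α)) ∪ Q
  refine ⟨ψ '' Y₀, ⟨?_, Subtype.val ⁻¹' (ψ '' Q), ?_, fun U hU hQU => ?_⟩, ?_⟩
  · rw [mk_image_eq hψ.injective, ← hbd]
    have hsub : range x ⊆ Prod.fst '' Y₀ := by
      rintro _ ⟨α, rfl⟩
      exact ⟨(x α, p α), Or.inl ⟨α, rfl⟩, rfl⟩
    exact hXc.trans ((mk_le_mk_of_subset hsub).trans mk_image_le)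
  · exact (hQ.image ψ).preimage Subtype.val_injective
  · obtain ⟨O, hO, rfl⟩ := isOpen_induced_iff.1 hU
    have hQO : ∀ z ∈ Q, ψ z ∈ O := fun z hz =>
      @hQU ⟨ψ z, z, Or.inr hz, rfl⟩ ⟨z, hz, rfl⟩
    obtain ⟨g, hg⟩ := exists_Ico_imp_mem (hO.preimage hψ.continuous) fun u p hu hp' =>
      hQO (u, p) ⟨hu, hp'⟩
    rw [← mk_image_eq (s := (Subtype.val ⁻¹' O : Set (ψ '' Y₀))ᶜ) Subtype.val_injective, ← hbd]
    refine ((mk_le_mk_of_subset ?_).trans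
      (mk_image_le (f := fun α => ψ (x α, p α)))).trans_lt (hbad g)
    rintro _ ⟨⟨_, z, hz, rfl⟩, hzO, rfl⟩
    rcases hz with ⟨α, rfl⟩ | hz
    · refine ⟨α, fun hev => hzO ?_, rfl⟩
      obtain ⟨a, h1, h2⟩ := ((hxh α).and_eventually hev).exists
      have h3 : Ico a (g a) ⊆ x α := (Ico_subset_Ico_right h2).trans h1
      exact hg _ _ a h3 ((hxp α).mono_left h3)
    · exact absurd (hQO z hz) hzO
  · let θ : ψ '' Y₀ → Set ℕ × Set ℕ :=
      fun y => hψ.toHomeomorph.symm ⟨y, image_subset_range _ _ y.2⟩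
    have hθ : Continuous θ := hψ.toHomeomorph.symm.continuous.comp (by fun_prop)
    have hθψ : ∀ z (hz : z ∈ Y₀), θ ⟨ψ z, z, hz, rfl⟩ = z := fun z hz =>
      hψ.toHomeomorph.symm_apply_apply z
    have hc1 : Continuous fun z : ↥(range x ∪ FinSets) × (ψ '' Y₀) => (z.1 : Set ℕ) :=
      continuous_subtype_val.comp continuous_fst
    have hc2 : Continuous fun z : ↥(range x ∪ FinSets) × (ψ '' Y₀) => (θ z.2).1 :=
      continuous_fst.comp (hθ.comp continuous_snd)
    have hc3 : Continuous fun z : ↥(range x ∪ FinSets) × (ψ '' Y₀) => (θ z.2).2 :=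
      continuous_snd.comp (hθ.comp continuous_snd)
    refine not_isMenger_of_continuous (F := fun z => symmDiff z.1.1 (θ z.2).1 ∪ (θ z.2).2)
      ?_ ?_ fun f => ?_
    · refine continuous_powerSet_iff.2 fun n => ?_
      have h1 := continuous_powerSet_iff.1 hc1 n
      have h2 := continuous_powerSet_iff.1 hc2 n
      exact ((h1.diff h2).union (h2.diff h1)).union (continuous_powerSet_iff.1 hc3 n)
    -- Adding p makes the value infinite at scale pairs. At a pair with cofinite first entry,
    -- finiteness of the symmetric difference would make `a` cofinite; but `a` is finite or misses
    -- the infinite set p_α.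
    · rintro ⟨⟨a, ha⟩, ⟨_, z, hz, rfl⟩⟩
      simp only [hθψ z hz]
      rcases hz with ⟨α, rfl⟩ | ⟨hu, -⟩
      · exact (hp α).mono subset_union_right
      refine Set.Infinite.mono subset_union_left fun hfin => ?_
      rcases ha with ⟨α, rfl⟩ | ha
      · refine hp α ((hfin.union hu).subset fun k hk => ?_)
        have hk' : k ∉ x α := fun h' => disjoint_left.1 (hxp α) h' hk
        by_cases h' : k ∈ z.1 <;> simp [mem_symmDiff, hk', h']
      · refine infinite_univ (α := ℕ) (((hfin.union hu).union ha).subset fun k _ => ?_)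
        by_cases h' : k ∈ z.1 <;> by_cases h'' : k ∈ a <;> simp [mem_symmDiff, h', h'']
    · obtain ⟨α, hα⟩ := hdom f
      have hz : (x α, p α) ∈ Y₀ := Or.inl ⟨α, rfl⟩
      refine ⟨⟨⟨x α, Or.inl ⟨α, rfl⟩⟩, ⟨_, _, hz, rfl⟩⟩, ?_⟩
      simp only [hθψ _ hz, symmDiff_self, bot_eq_empty, empty_union]
      exact hα.mono fun n hn => hn.trans (hph α n)

end SemifilterScales

theorem mainTheorem5
    (hbd : SemifilterScales.boundingNumber = SemifilterScales.dominatingNumber)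
    (S : Set (Set ℕ)) (hS : SemifilterScales.IsSemifilter S) :
    List.TFAE [
      ¬ IsMeagre S,
      ∃ X : Set (Set ℕ), SemifilterScales.IsScale S X ∧
        ∃ Y : Set ℝ, SemifilterScales.IsConcentrated SemifilterScales.dominatingNumber Y ∧
          ¬ SemifilterScales.IsMenger (↥(X ∪ SemifilterScales.FinSets) × Y),
      ∃ X : Set (Set ℕ), SemifilterScales.IsCofinalScale S X ∧
        ∃ Y : Set ℝ, SemifilterScales.IsConcentrated SemifilterScales.dominatingNumber Y ∧
          ¬ SemifilterScales.IsMenger (↥(X ∪ SemifilterScales.FinSets) × Y)] := by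
  tfae_have 1 → 3 := SemifilterScales.exists_isCofinalScale_not_isMenger hS hbd
  tfae_have 3 → 2 := fun ⟨X, hX, hY⟩ => ⟨X, hX.isScale hS, hY⟩
  tfae_have 2 → 1 := fun ⟨_, hX, _, hY, hXY⟩ hm => hXY (hX.isMenger_prod hS hbd hm hY)
  tfae_finish
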